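/- Notation. Let $\mathbb N=\{1,2,3,\dots\}$, $\mathbb T=\mathbb R/\mathbb Z$, and for $S\subset\mathbb N$ let $S(N)=S\cap\{1,\dots,N\}$. An infinite set $S\subset\mathbb N$ is *good* if for every $\alpha\in\mathbb T$ the limit $\lim_{N\to\infty}\frac1{\#S(N)}\sum_{s\in S(N)}e^{2\pi i s\alpha}$ exists. For a good set $S$ and $\alpha\in\mathbb T$ let $\mu_{S,\alpha}$ be the weak limit of the measures $\frac1{\#S(N)}\sum_{s\in S(N)}\delta_{s\alpha}$, that is, the Borel probability measure on $\mathbb T$ with $\int\phi\,d\mu_{S,\alpha}=\lim_{N\to\infty}\frac1{\#S(N)}\sum_{s\in S(N)}\phi(s\alpha)$ for every continuous $\phi:\mathbb T\to\mathbb C$ (it exists because $S$ is good). A good set $S$ *represents* a finite Borel measure $\nu$ at $\alpha$ if $\mu_{S,\alpha}=\frac1{\nu(\mathbb T)}\nu$. A set $R\subset\mathbb N$ is *sublacunary* if $\lim_{N\to\infty}\frac{\log N}{\#R(N)}=0$. For an infinite $R\subset \mathbb N$ and $S\subset R$ let $M_R(S)=\lim_{N\to\infty}\frac{\#S(N)}{\#R(N)}$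 (if the limit exists) and $\|S\|_{1,R}=\limsup_{N\to\infty}\frac{\#S(N)}{\#R(N)}$. Theorem. Let $R\subset\mathbb N$ be a sublacunary good set. (1) Let $\alpha$ be an irrational number and let $\rho\in L^1(\mu_{R,\alpha})$ be nonnegative with $\int\rho\,d\mu_{R,\alpha}=1$ and $\|\rho\|_{L^\infty(\mu_{R,\alpha})}<\infty$. Then there is a good set $S\subset R$ which represents the measure $\rho\cdot\mu_{R,\alpha}$ at $\alpha$ and for which $M_R(S)$ exists and equals $\dfrac1{\|\rho\|_{L^\infty(\mu_{R,\alpha})}}$. (2) Let $S\subset R$ be a good set with $\|S\|_{1,R}>0$. Then for every $\beta\in\mathbb T$ the measure $\mu_{S,\beta}$ is absolutely continuous with respect to $\mu_{R,\beta}$, and the Radon–Nikodym derivative $\rho_\beta=\frac{d\mu_{S,\beta}}{d\mu_{R,\beta}}$ is bounded, with $\|\rho_\beta\|_{L^\infty(\mu_{R,\beta})}\le\dfrac1{\|S\|_{1,R}}$. -/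

import Mathlib

open MeasureTheory Filter Topology
open scoped BigOperators ENNReal CompactlySupported

/-- The `N`-th initial segment `S(N) = S ∩ {1, …, N}` of a set `S` of positive integers. -/
noncomputable def initSeg (S : Set ℕ) (N : ℕ) : Finset ℕ :=
  open Classical in (Finset.Icc 1 N).filter (· ∈ S)

/-- `S` is a good set: an infinite set of positive integers such that for every `α` on the torus
`𝕋 = ℝ/ℤ` the averages of `e(sα) = exp(2πisα)` over `s ∈ S(N)` converge as `N → ∞`. -/
structure IsGoodSet (S : Set ℕ) : Prop where
  zero_notMem : 0 ∉ S
  infinite : S.Infinite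
  exists_tendsto : ∀ α : UnitAddCircle, ∃ z : ℂ,
    Tendsto (fun N : ℕ => 𝔼 s ∈ initSeg S N, (AddCircle.toCircle (s • α) : ℂ)) atTop (𝓝 z)

/-- `S` is sublacunary: `log N / #S(N) → 0`. -/
def IsSublacunary (S : Set ℕ) : Prop :=
  Tendsto (fun N : ℕ => Real.log N / ((initSeg S N).card : ℝ)) atTop (𝓝 0)

/-- `μ` is the weak limit, as `N → ∞`, of the transform measures, i.e. of the averages over
`s ∈ S(N)` of the point masses `δ_{sα}`. -/
def IsLimitMeasure (S : Set ℕ) (α : UnitAddCircle) (μ : ProbabilityMeasure UnitAddCircle) : Prop :=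
  ∀ φ : C(UnitAddCircle, ℂ),
    Tendsto (fun N : ℕ => 𝔼 s ∈ initSeg S N, φ (s • α)) atTop
      (𝓝 (∫ x, φ x ∂(μ : Measure UnitAddCircle)))

theorem eventually_initSeg_nonempty {S : Set ℕ} (hS : IsGoodSet S) :
    ∀ᶠ N in atTop, (initSeg S N).Nonempty := by
  obtain ⟨s, hs⟩ := hS.infinite.nonempty
  have h0 : s ≠ 0 := fun h => hS.zero_notMem (h ▸ hs)
  filter_upwards [eventually_ge_atTop s] with N hN
  exact ⟨s, by simp only [initSeg, Finset.mem_filter, Finset.mem_Icc]; exact ⟨by omega, hs⟩⟩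

theorem norm_expect_initSeg_le (S : Set ℕ) (α : UnitAddCircle) (φ : C(UnitAddCircle, ℂ)) (N : ℕ) :
    ‖𝔼 s ∈ initSeg S N, φ (s • α)‖ ≤ ‖φ‖ := by
  rw [Finset.expect_eq_sum_div_card, norm_div, Complex.norm_natCast]
  refine div_le_of_le_mul₀ (by positivity) (by positivity) ?_
  refine (norm_sum_le _ _).trans ?_
  refine (Finset.sum_le_sum (fun s _ => φ.norm_coe_le_norm (s • α))).trans ?_
  simp [mul_comm]

/-- Along a good set, the averages of every continuous function converge. -/
theorem IsGoodSet.exists_tendsto_continuous {S : Set ℕ} (hS : IsGoodSet S) (α : UnitAddCircle)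
    (φ : C(UnitAddCircle, ℂ)) : ∃ z : ℂ,
    Tendsto (fun N : ℕ => 𝔼 s ∈ initSeg S N, φ (s • α)) atTop (𝓝 z) := by
  let V : Submodule ℂ C(UnitAddCircle, ℂ) :=
    { carrier := {φ | ∃ z : ℂ, Tendsto (fun N : ℕ => 𝔼 s ∈ initSeg S N, φ (s • α)) atTop (𝓝 z)}
      zero_mem' := ⟨0, by simp⟩
      add_mem' := by
        rintro f g ⟨z, hz⟩ ⟨w, hw⟩
        exact ⟨z + w, by simpa [Finset.expect_add_distrib] using hz.add hw⟩
      smul_mem' := by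
        rintro c f ⟨z, hz⟩
        exact ⟨c * z, by simpa [Finset.mul_expect] using hz.const_mul c⟩ }
  have hV : Submodule.span ℂ (Set.range (fourier (T := (1 : ℝ)))) ≤ V := by
    rw [Submodule.span_le]
    rintro _ ⟨n, rfl⟩
    obtain ⟨z, hz⟩ := hS.exists_tendsto (n • α)
    refine ⟨z, hz.congr fun N => ?_⟩
    refine Finset.expect_congr rfl fun s _ => ?_
    rw [fourier_apply, smul_comm]
  have hφ : φ ∈ (Submodule.span ℂ (Set.range (fourier (T := (1 : ℝ))))).topologicalClosure := by
    have : Fact ((0 : ℝ) < 1) := ⟨one_pos⟩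
    rw [span_fourier_closure_eq_top]; trivial
  refine cauchySeq_tendsto_of_complete (Metric.cauchySeq_iff'.2 fun ε hε => ?_)
  have hφ' : φ ∈ closure (V : Set C(UnitAddCircle, ℂ)) := closure_mono hV hφ
  obtain ⟨ψ, ⟨z, hz⟩, hψ⟩ := Metric.mem_closure_iff.1 hφ' (ε / 3) (by positivity)
  obtain ⟨N₀, hN₀⟩ := Metric.cauchySeq_iff'.1 hz.cauchySeq (ε / 3) (by positivity)
  refine ⟨N₀, fun N hN => ?_⟩
  have key : ∀ M : ℕ, dist (𝔼 s ∈ initSeg S M, φ (s • α)) (𝔼 s ∈ initSeg S M, ψ (s • α))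
      < ε / 3 := by
    intro M
    refine lt_of_le_of_lt ?_ hψ
    rw [dist_eq_norm, dist_eq_norm, ← Finset.expect_sub_distrib]
    exact norm_expect_initSeg_le S α (φ - ψ) M
  have h1 := key N
  have h2 := key N₀
  have h3 := hN₀ N hN
  have h4 := dist_triangle4_right (𝔼 s ∈ initSeg S N, φ (s • α)) (𝔼 s ∈ initSeg S N₀, φ (s • α))
    (𝔼 s ∈ initSeg S N, ψ (s • α)) (𝔼 s ∈ initSeg S N₀, ψ (s • α))
  linarith

/-- Along a good set, the limit measure exists at every point. -/
theorem IsGoodSet.exists_isLimitMeasure {S : Set ℕ} (hS : IsGoodSet S) (α : UnitAddCircle) :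
    ∃ μ : ProbabilityMeasure UnitAddCircle, IsLimitMeasure S α μ := by
  have hreal : ∀ f : C(UnitAddCircle, ℝ), ∃ l : ℝ,
      Tendsto (fun N : ℕ => 𝔼 s ∈ initSeg S N, f (s • α)) atTop (𝓝 l) := by
    intro f
    obtain ⟨z, hz⟩ := hS.exists_tendsto_continuous α
      ⟨fun x => (f x : ℂ), Complex.continuous_ofReal.comp f.continuous⟩
    refine ⟨z.re, ((Complex.continuous_re.tendsto z).comp hz).congr fun N => ?_⟩
    simp only [Function.comp, ContinuousMap.coe_mk, Finset.expect_eq_sum_div_card]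
    norm_cast
  choose L hL using hreal
  let Λ : C_c(UnitAddCircle, ℝ) →ₚ[ℝ] ℝ := PositiveLinearMap.mk₀
    { toFun := fun f => L f.toContinuousMap
      map_add' := fun f g => tendsto_nhds_unique (hL _)
        (((hL f.toContinuousMap).add (hL g.toContinuousMap)).congr fun N => by
          rw [← Finset.expect_add_distrib]; rfl)
      map_smul' := fun c f => tendsto_nhds_unique (hL _)
        (((hL f.toContinuousMap).const_mul c).congr fun N => by
          rw [Finset.mul_expect]; rfl) }
    (fun f hf => ge_of_tendsto' (hL f.toContinuousMap) fun N =>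
      Finset.expect_nonneg fun s _ => hf (s • α))
  let ν : Measure UnitAddCircle := RealRMK.rieszMeasure Λ
  have hν : ∀ f : C(UnitAddCircle, ℝ), ∫ x, f x ∂ν = L f := fun f =>
    RealRMK.integral_rieszMeasure Λ ⟨f, HasCompactSupport.of_compactSpace _⟩
  have hfin : IsFiniteMeasure ν := ⟨isCompact_univ.measure_lt_top⟩
  have h1 : L 1 = 1 := by
    refine tendsto_nhds_unique (hL 1) (tendsto_const_nhds.congr' ?_)
    filter_upwards [eventually_initSeg_nonempty hS] with N hN
    simp [Finset.expect_const hN]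
  have hprob : IsProbabilityMeasure ν := by
    have h := hν 1
    simp only [ContinuousMap.one_apply, integral_const, smul_eq_mul, mul_one, h1] at h
    refine ⟨?_⟩
    rw [← ENNReal.toReal_eq_one_iff]
    exact h
  refine ⟨⟨ν, hprob⟩, fun φ => ?_⟩
  obtain ⟨z, hz⟩ := hS.exists_tendsto_continuous α φ
  have hint : Integrable φ ν :=
    φ.continuous.integrable_of_hasCompactSupport (HasCompactSupport.of_compactSpace _)
  have hzν : z = ∫ x, φ x ∂ν := by
    apply Complex.ext
    · have e : (∫ x, φ x ∂ν).re = ∫ x, (φ x).re ∂ν := (integral_re hint).symm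
      rw [e]
      refine (tendsto_nhds_unique ?_ (hL ⟨fun x => (φ x).re, by fun_prop⟩)).trans (hν _).symm
      refine ((Complex.continuous_re.tendsto z).comp hz).congr fun N => ?_
      simp [Finset.expect_eq_sum_div_card, Complex.div_natCast_re]
    · have e : (∫ x, φ x ∂ν).im = ∫ x, (φ x).im ∂ν := (integral_im hint).symm
      rw [e]
      refine (tendsto_nhds_unique ?_ (hL ⟨fun x => (φ x).im, by fun_prop⟩)).trans (hν _).symm
      refine ((Complex.continuous_im.tendsto z).comp hz).congr fun N => ?_
      simp [Finset.expect_eq_sum_div_card, Complex.div_natCast_im]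
  rw [hzν] at hz
  exact hz

/-- The limit measure `μ_{S,α}` of a good set `S` at `α`. -/
noncomputable def IsGoodSet.limitMeasure {S : Set ℕ} (hS : IsGoodSet S) (α : UnitAddCircle) :
    ProbabilityMeasure UnitAddCircle :=
  (hS.exists_isLimitMeasure α).choose

theorem IsGoodSet.isLimitMeasure {S : Set ℕ} (hS : IsGoodSet S) (α : UnitAddCircle) :
    IsLimitMeasure S α (hS.limitMeasure α) :=
  (hS.exists_isLimitMeasure α).choose_spec

/-- The good set `S` represents the finite Borel measure `ν` at `α`:
`μ_{S,α} = ν / ν(𝕋)`. -/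
def Represents (S : Set ℕ) (ν : Measure UnitAddCircle) (α : UnitAddCircle) : Prop :=
  ∃ hS : IsGoodSet S,
    (hS.limitMeasure α : Measure UnitAddCircle) = (ν Set.univ)⁻¹ • ν

/-- The relative mean `M_R(f)`, the limit of the averages of `f` over `R(N)`, exists and
equals `m`. -/
def HasRelMean (R : Set ℕ) (f : ℕ → ℂ) (m : ℂ) : Prop :=
  Tendsto (fun N : ℕ => 𝔼 r ∈ initSeg R N, f r) atTop (𝓝 m)

/-- The relative seminorm `‖f‖_{1,R}`, the upper limit in `[0, ∞]` of the averages of `|f|` over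
`R(N)`. -/
noncomputable def relNorm (R : Set ℕ) (f : ℕ → ℂ) : ℝ≥0∞ :=
  limsup (fun N : ℕ => ENNReal.ofReal (𝔼 r ∈ initSeg R N, ‖f r‖)) atTop

/-! Part (2) is a comparison of averages. For continuous `f ≥ 0`, the ratio `#S(N)/#R(N)` times the
average of `f (s • β)` over `S(N)` is the average over `R(N)` of the same function cut off to `S`,
hence at most its full average over `R(N)`. In the limit `‖S‖_{1,R} • μ_{S,β} ≤ μ_{R,β}` as measures
(`relNorm_smul_le`), which gives absolute continuity and the bound on the derivative.

For part (1) put `L = ‖ρ‖_∞` and `g = ρ / L`, with values in `[0, 1]`. Continuous `h k → g` in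
`L¹(μ_{R,α})` give sequences `r ↦ h k (r • α)` that are Cauchy in mean along `R`. Gluing them over
successive blocks yields weights `w r ∈ [0, 1]` whose averages against `e(rβ)` converge for every
`β`, with limit `∫ g · fourier m` when `β = m • α` (`IsGoodSet.exists_weight`).

Now put each `r ∈ R` into `S` independently with probability `w r`. By Hoeffding's inequality an
exponential sum of `1_S - w` over `R(N)` exceeds `ε #R(N)` with probability at most `exp(-ε² #R(N) /
2)`. Sublacunarity makes this smaller than any power of `N`, so Borel–Cantelli over `N²` grid
frequencies controls all `β` at once (`exists_subset_tendsto_zero`). Hence `1_S` and `w` have the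
same exponential averages: frequency `0` gives `M_R(S) = 1 / L`, all frequencies together make `S`
good, and the frequencies `m • α` give the Fourier coefficients of `ρ μ_{R,α}`. -/

/-! ### Averages over a subset as averages of a cut-off function. -/

theorem mem_initSeg {S : Set ℕ} {N s : ℕ} : s ∈ initSeg S N ↔ (1 ≤ s ∧ s ≤ N) ∧ s ∈ S := by
  simp [initSeg]

theorem initSeg_eq_filter {S R : Set ℕ} [DecidablePred (· ∈ S)] (h : S ⊆ R) (N : ℕ) :
    initSeg S N = (initSeg R N).filter (· ∈ S) := by
  ext s
  simp only [Finset.mem_filter, mem_initSeg]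
  exact ⟨fun hs => ⟨⟨hs.1, h hs.2⟩, hs.2⟩, fun hs => ⟨hs.1.1, hs.2⟩⟩

theorem sum_initSeg_indicator {M : Type*} [AddCommMonoid M] {S R : Set ℕ} (h : S ⊆ R) (f : ℕ → M)
    (N : ℕ) : ∑ r ∈ initSeg R N, S.indicator f r = ∑ s ∈ initSeg S N, f s := by
  classical
  rw [initSeg_eq_filter h, Finset.sum_filter]
  exact Finset.sum_congr rfl fun r _ => by rw [Set.indicator_apply]

/-- Averages over `R` of a function supported on `S ⊆ R`. -/
theorem expect_indicator {𝕜 : Type*} [Field 𝕜] [CharZero 𝕜] {S R : Set ℕ} (h : S ⊆ R)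
    (f : ℕ → 𝕜) (N : ℕ) : 𝔼 r ∈ initSeg R N, S.indicator f r =
      ((initSeg S N).card / (initSeg R N).card : 𝕜) * 𝔼 s ∈ initSeg S N, f s := by
  rw [Finset.expect_eq_sum_div_card, Finset.expect_eq_sum_div_card, sum_initSeg_indicator h]
  rcases (initSeg S N).eq_empty_or_nonempty with h0 | h0
  · simp [h0]
  · have : ((initSeg S N).card : 𝕜) ≠ 0 := by exact_mod_cast h0.card_pos.ne'
    field_simp

theorem expect_norm_indicator_one {S R : Set ℕ} (h : S ⊆ R) (N : ℕ) :
    𝔼 r ∈ initSeg R N, ‖S.indicator (1 : ℕ → ℂ) r‖ =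
      ((initSeg S N).card / (initSeg R N).card : ℝ) := by
  have : ∀ r, ‖S.indicator (1 : ℕ → ℂ) r‖ = S.indicator (1 : ℕ → ℝ) r := fun r => by
    by_cases hr : r ∈ S <;> simp [hr]
  simp only [this]
  rw [Finset.expect_eq_sum_div_card, sum_initSeg_indicator h]
  simp

/-! ### Domination of limit measures, for part (2). -/

/-- Real form of the weak convergence to the limit measure. -/
theorem IsLimitMeasure.tendsto_real {S : Set ℕ} {α : UnitAddCircle}
    {μ : ProbabilityMeasure UnitAddCircle} (h : IsLimitMeasure S α μ) (f : C(UnitAddCircle, ℝ)) :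
    Tendsto (fun N : ℕ => 𝔼 s ∈ initSeg S N, f (s • α)) atTop
      (𝓝 (∫ x, f x ∂(μ : Measure UnitAddCircle))) := by
  have := h ⟨fun x => (f x : ℂ), Complex.continuous_ofReal.comp f.continuous⟩
  simp only [ContinuousMap.coe_mk] at this
  rw [integral_complex_ofReal] at this
  refine ((Complex.continuous_re.tendsto _).comp this).congr fun N => ?_
  simp only [Function.comp, Finset.expect_eq_sum_div_card]
  norm_cast

theorem integrable_continuousMap {E : Type*} [NormedAddCommGroup E] (μ : Measure UnitAddCircle)
    [IsFiniteMeasure μ] (f : C(UnitAddCircle, E)) : Integrable f μ :=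
  f.continuous.integrable_of_hasCompactSupport (HasCompactSupport.of_compactSpace _)

/-- Domination of finite measures can be tested on bounded continuous functions. -/
theorem measure_le_of_forall_lintegral_le {Ω : Type*} [TopologicalSpace Ω]
    [TopologicalSpace.PseudoMetrizableSpace Ω] [MeasurableSpace Ω] [BorelSpace Ω]
    (μ ν : Measure Ω) [IsFiniteMeasure μ] [IsFiniteMeasure ν]
    (h : ∀ f : BoundedContinuousFunction Ω NNReal, ∫⁻ x, f x ∂μ ≤ ∫⁻ x, f x ∂ν) : μ ≤ ν := by
  refine Measure.le_iff.2 fun A hA => ?_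
  -- Inner regularity reduces to closed sets, whose indicators are limits of bounded continuous
  -- functions.
  rw [hA.measure_eq_iSup_isClosed_of_ne_top (measure_ne_top μ A)]
  refine iSup₂_le fun F hFA => iSup_le fun hF => ?_
  exact (le_of_tendsto_of_tendsto' (HasOuterApproxClosed.tendsto_lintegral_apprSeq hF μ)
    (HasOuterApproxClosed.tendsto_lintegral_apprSeq hF ν) fun n => h _).trans (measure_mono hFA)

theorem relNorm_mul_integral_le {R S : Set ℕ} (hSR : S ⊆ R) {β : UnitAddCircle}
    {μ ν : ProbabilityMeasure UnitAddCircle} (hμ : IsLimitMeasure S β μ)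
    (hν : IsLimitMeasure R β ν) (f : C(UnitAddCircle, ℝ)) (hf : 0 ≤ f) :
    relNorm R (S.indicator 1) * ENNReal.ofReal (∫ x, f x ∂(μ : Measure UnitAddCircle)) ≤
      ENNReal.ofReal (∫ x, f x ∂(ν : Measure UnitAddCircle)) := by
  have hA := ENNReal.tendsto_ofReal (hμ.tendsto_real f)
  have hB := ENNReal.tendsto_ofReal (hν.tendsto_real f)
  set A := ENNReal.ofReal (∫ x, f x ∂(μ : Measure UnitAddCircle))
  set B := ENNReal.ofReal (∫ x, f x ∂(ν : Measure UnitAddCircle))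
  by_cases hA0 : A = 0
  · simp [hA0]
  have hAt : A ≠ ∞ := ENNReal.ofReal_ne_top
  -- Dividing by the nonzero limit `A` turns limsup times limit into a comparison of two limsups,
  -- which can be checked for each large `N`.
  rw [← ENNReal.le_div_iff_mul_le (.inl hA0) (.inl hAt),
    ← (ENNReal.Tendsto.div hB (.inr hA0) hA (.inl ENNReal.ofReal_ne_top)).limsup_eq]
  refine limsup_le_limsup ?_ (by isBoundedDefault) (by isBoundedDefault)
  filter_upwards [hA.eventually_ne hA0] with N hN
  rw [ENNReal.le_div_iff_mul_le (.inl hN) (.inl ENNReal.ofReal_ne_top), expect_norm_indicator_one hSR,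
    ← ENNReal.ofReal_mul (by positivity)]
  refine ENNReal.ofReal_le_ofReal ?_
  rw [← expect_indicator hSR (fun s => f (s • β))]
  exact Finset.expect_le_expect fun r _ => Set.indicator_le_self' (fun _ _ => hf _) _

theorem relNorm_smul_le {R S : Set ℕ} (hSR : S ⊆ R) {β : UnitAddCircle}
    {μ ν : ProbabilityMeasure UnitAddCircle} (hμ : IsLimitMeasure S β μ)
    (hν : IsLimitMeasure R β ν) :
    relNorm R (S.indicator 1) ≤ 1 ∧
      relNorm R (S.indicator 1) • (μ : Measure UnitAddCircle) ≤ ν := by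
  have h1 : relNorm R (S.indicator 1) ≤ 1 := by
    simpa using relNorm_mul_integral_le hSR hμ hν 1 zero_le_one
  have : IsFiniteMeasure (relNorm R (S.indicator 1) • (μ : Measure UnitAddCircle)) :=
    Measure.smul_finite _ (h1.trans_lt ENNReal.one_lt_top).ne
  refine ⟨h1, measure_le_of_forall_lintegral_le _ _ fun f => ?_⟩
  let F : C(UnitAddCircle, ℝ) := ⟨fun x => (f x : ℝ), by fun_prop⟩
  have key : ∀ κ : ProbabilityMeasure UnitAddCircle,
      ∫⁻ x, f x ∂(κ : Measure UnitAddCircle) =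
        ENNReal.ofReal (∫ x, F x ∂(κ : Measure UnitAddCircle)) := fun κ => by
    rw [ofReal_integral_eq_lintegral_ofReal (integrable_continuousMap _ F)
      (ae_of_all _ fun x => (f x).2)]
    simp [F]
  rw [lintegral_smul_measure, key, key]
  exact relNorm_mul_integral_le hSR hμ hν F fun x => (f x).2

/-- Positive relative upper density bounds the density of the limit measures. -/
theorem absolutelyContinuous_and_rnDeriv_le {R S : Set ℕ} (hSR : S ⊆ R) {β : UnitAddCircle}
    {μ ν : ProbabilityMeasure UnitAddCircle} (hμ : IsLimitMeasure S β μ)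
    (hν : IsLimitMeasure R β ν) (h0 : 0 < relNorm R (S.indicator 1)) :
    (μ : Measure UnitAddCircle) ≪ ν ∧
      eLpNorm ((μ : Measure UnitAddCircle).rnDeriv ν) ∞ (ν : Measure UnitAddCircle) ≤
        1 / relNorm R (S.indicator 1) := by
  obtain ⟨h1, hle⟩ := relNorm_smul_le hSR hμ hν
  set c := relNorm R (S.indicator 1)
  have hct : c ≠ ∞ := (h1.trans_lt ENNReal.one_lt_top).ne
  have hle' : ∀ A, (μ : Measure UnitAddCircle) A ≤ c⁻¹ * (ν : Measure UnitAddCircle) A := fun A => by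
    have := hle A
    rw [Measure.smul_apply, smul_eq_mul] at this
    rw [mul_comm, ← div_eq_mul_inv, ENNReal.le_div_iff_mul_le (.inl h0.ne') (.inl hct), mul_comm]
    exact this
  refine ⟨fun A hA => by simpa [hA] using hle' A, ?_⟩
  rw [eLpNorm_exponent_top, one_div]
  refine essSup_le_of_ae_le _ ?_
  simp only [enorm_eq_self]
  -- An a.e. upper bound on the derivative may be tested by integrating over measurable sets.
  refine ae_le_of_forall_setLIntegral_le_of_sigmaFinite (Measure.measurable_rnDeriv _ _)
    fun A hA _ => (Measure.setLIntegral_rnDeriv_le A).trans ?_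
  rw [setLIntegral_const]
  exact hle' A

/-! ### Convergence by approximation, and twisted averages. -/

theorem tendsto_card_initSeg {S : Set ℕ} (h0 : 0 ∉ S) (hS : S.Infinite) :
    Tendsto (fun N => (initSeg S N).card) atTop atTop := by
  refine tendsto_atTop.2 fun b => ?_
  obtain ⟨t, htS, rfl⟩ := hS.exists_subset_card_eq b
  filter_upwards [eventually_ge_atTop (t.sup id)] with N hN
  refine Finset.card_le_card fun s hs => mem_initSeg.2 ⟨⟨?_, ?_⟩, htS hs⟩
  · exact Nat.one_le_iff_ne_zero.2 fun h => h0 (h ▸ htS hs)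
  · exact (Finset.le_sup (f := id) hs).trans hN

theorem IsGoodSet.tendsto_card {S : Set ℕ} (hS : IsGoodSet S) :
    Tendsto (fun N => ((initSeg S N).card : ℝ)) atTop atTop :=
  tendsto_natCast_atTop_atTop.comp (tendsto_card_initSeg hS.zero_notMem hS.infinite)

/-- A sequence that is eventually close to convergent sequences converges. -/
theorem exists_tendsto_of_approx {E : Type*} [NormedAddCommGroup E] [CompleteSpace E] {u : ℕ → E}
    (h : ∀ ε > 0, ∃ (v : ℕ → E) (z : E), Tendsto v atTop (𝓝 z) ∧ ∀ᶠ N in atTop, ‖u N - v N‖ ≤ ε) :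
    ∃ z, Tendsto u atTop (𝓝 z) := by
  refine cauchySeq_tendsto_of_complete (Metric.cauchySeq_iff'.2 fun ε hε => ?_)
  obtain ⟨v, z, hv, huv⟩ := h (ε / 4) (by positivity)
  have hv' := hv.eventually (Metric.ball_mem_nhds z (ε := ε / 4) (by positivity))
  obtain ⟨N₀, hN₀⟩ := eventually_atTop.1 (huv.and hv')
  refine ⟨N₀, fun N hN => ?_⟩
  have h1 := hN₀ N hN
  have h2 := hN₀ N₀ le_rfl
  rw [← dist_eq_norm] at h1 h2
  have := dist_triangle4_right (u N) (u N₀) (v N) (v N₀)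
  have := dist_triangle_right (v N) (v N₀) z
  linarith [h1.1, h2.1, Metric.mem_ball.1 h1.2, Metric.mem_ball.1 h2.2]

theorem tendsto_of_approx {E : Type*} [NormedAddCommGroup E] {u : ℕ → E} {z : E}
    (h : ∀ ε > 0, ∃ (v : ℕ → E) (y : E), Tendsto v atTop (𝓝 y) ∧ ‖y - z‖ ≤ ε ∧
      ∀ᶠ N in atTop, ‖u N - v N‖ ≤ ε) : Tendsto u atTop (𝓝 z) := by
  refine Metric.tendsto_nhds.2 fun ε hε => ?_
  obtain ⟨v, y, hv, hyz, huv⟩ := h (ε / 4) (by positivity)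
  filter_upwards [huv, hv.eventually (Metric.ball_mem_nhds y (ε := ε / 4) (by positivity))]
    with N h1 h2
  rw [← dist_eq_norm] at h1 hyz
  have := dist_triangle4 (u N) (v N) y z
  linarith [Metric.mem_ball.1 h2]

/-- Along a good set, averages of continuous functions twisted by a character converge. -/
theorem IsGoodSet.exists_tendsto_twisted {S : Set ℕ} (hS : IsGoodSet S) (α β : UnitAddCircle)
    (φ : C(UnitAddCircle, ℂ)) : ∃ z : ℂ,
    Tendsto (fun N : ℕ => 𝔼 s ∈ initSeg S N, φ (s • α) * (AddCircle.toCircle (s • β) : ℂ))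
      atTop (𝓝 z) := by
  let V : Submodule ℂ C(UnitAddCircle, ℂ) :=
    { carrier := {φ | ∃ z : ℂ, Tendsto (fun N : ℕ => 𝔼 s ∈ initSeg S N,
        φ (s • α) * (AddCircle.toCircle (s • β) : ℂ)) atTop (𝓝 z)}
      zero_mem' := ⟨0, by simp⟩
      add_mem' := by
        rintro f g ⟨z, hz⟩ ⟨w, hw⟩
        exact ⟨z + w, by simpa [Finset.expect_add_distrib, add_mul] using hz.add hw⟩
      smul_mem' := by
        rintro c f ⟨z, hz⟩
        exact ⟨c * z, by simpa [Finset.mul_expect, mul_assoc] using hz.const_mul c⟩ }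
  have hV : Submodule.span ℂ (Set.range (fourier (T := (1 : ℝ)))) ≤ V := by
    rw [Submodule.span_le]
    rintro _ ⟨n, rfl⟩
    -- For a character the twist only shifts the frequency, so goodness applies directly.
    obtain ⟨z, hz⟩ := hS.exists_tendsto (n • α + β)
    refine ⟨z, hz.congr fun N => Finset.expect_congr rfl fun s _ => ?_⟩
    rw [fourier_apply, smul_comm, ← Circle.coe_mul, ← AddCircle.toCircle_add, smul_add]
  have hφ : φ ∈ (Submodule.span ℂ (Set.range (fourier (T := (1 : ℝ))))).topologicalClosure := by
    have : Fact ((0 : ℝ) < 1) := ⟨one_pos⟩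
    rw [span_fourier_closure_eq_top]; trivial
  refine exists_tendsto_of_approx fun ε hε => ?_
  have hφ' : φ ∈ closure (V : Set C(UnitAddCircle, ℂ)) := closure_mono hV hφ
  obtain ⟨ψ, ⟨z, hz⟩, hψ⟩ := Metric.mem_closure_iff.1 hφ' ε hε
  refine ⟨_, z, hz, Eventually.of_forall fun N => ?_⟩
  rw [← Finset.expect_sub_distrib]
  refine (RCLike.norm_expect_le (K := ℂ)).trans ?_
  rcases (initSeg S N).eq_empty_or_nonempty with h0 | h0
  · simp [h0, hε.le]
  refine Finset.expect_le h0 fun s _ => ?_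
  rw [← sub_mul, norm_mul, Circle.norm_coe, mul_one, ← dist_eq_norm]
  exact (ContinuousMap.dist_apply_le_dist _).trans hψ.le

/-! ### Weights realising a bounded density. -/

/-- A sequence of functions which is Cauchy in mean along `R` has a limit in mean, obtained by
gluing. -/
theorem exists_limit_in_mean {R : Set ℕ} (hR : Tendsto (fun N => ((initSeg R N).card : ℝ)) atTop atTop)
    {f : ℕ → ℕ → ℝ} (hf : ∀ k r, f k r ∈ Set.Icc (0 : ℝ) 1)
    (hd : ∀ k, ∀ᶠ N in atTop, 𝔼 r ∈ initSeg R N, |f (k + 1) r - f k r| ≤ (1 / 2 : ℝ) ^ k) :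
    ∃ w : ℕ → ℝ, (∀ r, w r ∈ Set.Icc (0 : ℝ) 1) ∧
      ∀ K, ∀ᶠ N in atTop, 𝔼 r ∈ initSeg R N, |w r - f K r| ≤ 3 * (1 / 2 : ℝ) ^ K := by
  obtain ⟨φ, hφ, hφd⟩ := extraction_forall_of_eventually' fun k => eventually_atTop.1
    (eventually_forall_ge_atTop.2 (hd k))
  -- The glued function follows `f k` for `φ k ≤ r < φ (k + 1)`. Since `k ≤ φ k`, searching only up
  -- to `r` loses nothing; the default value `0` is used when `r < φ 0`.
  let κ : ℕ → ℕ := fun r => Nat.findGreatest (fun k => φ k ≤ r) r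
  refine ⟨fun r => f (κ r) r, fun r => hf _ _, fun K => ?_⟩
  have hsmall : ∀ᶠ N in atTop, (φ K : ℝ) / (initSeg R N).card ≤ (1 / 2 : ℝ) ^ K :=
    (hR.const_div_atTop (φ K : ℝ)).eventually_le_const (by positivity)
  filter_upwards [hsmall] with N hN
  -- These are the indices whose mean estimate is already valid at time `N`. For `φ K ≤ r ≤ N`,
  -- telescoping from `K` to `κ r` uses only such indices. The at most `φ K` earlier terms are
  -- negligible; they contribute one of the three units in the bound, the geometric tail the other
  -- two.
  let I := (Finset.Ico K (N + 1)).filter (φ · ≤ N)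
  have hpt : ∀ r ∈ initSeg R N, |f (κ r) r - f K r| ≤
      (if r < φ K then 1 else 0) + ∑ i ∈ I, |f (i + 1) r - f i r| := by
    intro r hr
    have hrN := (mem_initSeg.1 hr).1.2
    split_ifs with h
    · have : |f (κ r) r - f K r| ≤ 1 := by
        have := hf (κ r) r
        have := hf K r
        simp only [Set.mem_Icc] at *
        rw [abs_le]; constructor <;> linarith
      linarith [Finset.sum_nonneg fun i (_ : i ∈ I) => abs_nonneg (f (i + 1) r - f i r)]
    · push Not at h
      have hKκ : K ≤ κ r := Nat.le_findGreatest ((hφ.id_le K).trans h) h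
      have hκ : φ (κ r) ≤ r := Nat.findGreatest_spec (P := fun k => φ k ≤ r)
        ((hφ.id_le K).trans h) h
      rw [zero_add, ← Finset.sum_Ico_sub (fun i => f i r) hKκ]
      refine (Finset.abs_sum_le_sum_abs _ _).trans
        (Finset.sum_le_sum_of_subset_of_nonneg (fun i hi => ?_) fun _ _ _ => abs_nonneg _)
      rw [Finset.mem_Ico] at hi
      have h3 := hφ hi.2
      have h4 := Nat.findGreatest_le (P := fun k => φ k ≤ r) r
      simp only [I, Finset.mem_filter, Finset.mem_Ico]
      change κ r ≤ r at h4
      omega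
  refine (Finset.expect_le_expect hpt).trans ?_
  rw [Finset.expect_add_distrib, Finset.expect_sum_comm]
  have h1 : 𝔼 r ∈ initSeg R N, (if r < φ K then 1 else 0 : ℝ) ≤ (1 / 2 : ℝ) ^ K := by
    refine le_trans ?_ hN
    rw [Finset.expect_eq_sum_div_card, Finset.sum_boole]
    gcongr
    calc _ ≤ (Finset.range (φ K)).card := Finset.card_le_card fun r hr => by
            simpa using (Finset.mem_filter.1 hr).2
      _ = φ K := Finset.card_range _
  have h2 : ∑ i ∈ I, 𝔼 r ∈ initSeg R N, |f (i + 1) r - f i r| ≤ 2 * (1 / 2 : ℝ) ^ K := by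
    calc _ ≤ ∑ i ∈ I, (1 / 2 : ℝ) ^ i :=
          Finset.sum_le_sum fun i hi => hφd i N (Finset.mem_filter.1 hi).2
      _ ≤ ∑ i ∈ Finset.Ico K (N + 1), (1 / 2 : ℝ) ^ i :=
          Finset.sum_le_sum_of_subset_of_nonneg (Finset.filter_subset _ _) fun _ _ _ => by positivity
      _ ≤ _ := by
          refine (geom_sum_Ico_le_of_lt_one (by norm_num) (by norm_num)).trans_eq ?_
          ring
  linarith

/-- A `[0, 1]`-valued density is approximated in mean by continuous `[0, 1]`-valued functions. -/
theorem exists_continuousMap_integral_sub_le (μ : Measure UnitAddCircle) [IsProbabilityMeasure μ]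
    {g : UnitAddCircle → ℝ} (hg : AEStronglyMeasurable g μ) (hg01 : ∀ᵐ x ∂μ, g x ∈ Set.Icc (0 : ℝ) 1)
    {ε : ℝ} (hε : 0 < ε) : ∃ h : C(UnitAddCircle, ℝ), (∀ x, h x ∈ Set.Icc (0 : ℝ) 1) ∧
      ∫ x, |g x - h x| ∂μ ≤ ε := by
  have hgi : Integrable g μ := Integrable.of_mem_Icc 0 1 hg.aemeasurable hg01
  obtain ⟨f, hf, hfi⟩ := hgi.exists_boundedContinuous_integral_sub_le hε
  -- Truncation to `[0, 1]` is 1-Lipschitz and fixes `g` a.e., so it does not increase the error.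
  let h : C(UnitAddCircle, ℝ) := ⟨fun x => max 0 (min 1 (f x)), by fun_prop⟩
  refine ⟨h, fun x => ⟨le_max_left _ _, max_le zero_le_one (min_le_left _ _)⟩, le_trans ?_ hf⟩
  refine integral_mono_ae (hgi.sub (integrable_continuousMap μ h)).abs (hgi.sub hfi).norm ?_
  filter_upwards [hg01] with x hx
  change |g x - max 0 (min 1 (f x))| ≤ |g x - f x|
  have : g x = max 0 (min 1 (g x)) := by rw [min_eq_right hx.2, max_eq_right hx.1]
  conv_lhs => rw [this]
  refine (abs_max_sub_max_le_max _ _ _ _).trans (max_le (by simp) ?_)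
  exact (abs_min_sub_min_le_max _ _ _ _).trans (max_le (by simp) le_rfl)

theorem norm_expect_mul_toCircle_le (s : Finset ℕ) (a : ℕ → ℝ) (β : UnitAddCircle) :
    ‖𝔼 r ∈ s, (a r : ℂ) * (AddCircle.toCircle (r • β) : ℂ)‖ ≤ 𝔼 r ∈ s, |a r| := by
  refine (RCLike.norm_expect_le (K := ℂ)).trans_eq (Finset.expect_congr rfl fun r _ => ?_)
  rw [norm_mul, Circle.norm_coe, mul_one, Complex.norm_real, Real.norm_eq_abs]

/-- Every `[0, 1]`-valued density with respect to the limit measure of a good set is realised by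
`[0, 1]`-valued weights whose twisted averages converge. -/
theorem IsGoodSet.exists_weight {R : Set ℕ} (hR : IsGoodSet R) {α : UnitAddCircle}
    {μ : ProbabilityMeasure UnitAddCircle} (hμ : IsLimitMeasure R α μ)
    {g : UnitAddCircle → ℝ} (hg : AEStronglyMeasurable g (μ : Measure UnitAddCircle))
    (hg01 : ∀ᵐ x ∂(μ : Measure UnitAddCircle), g x ∈ Set.Icc (0 : ℝ) 1) :
    ∃ w : ℕ → ℝ, (∀ r, w r ∈ Set.Icc (0 : ℝ) 1) ∧
      (∀ β : UnitAddCircle, ∃ z : ℂ, Tendsto (fun N => 𝔼 r ∈ initSeg R N,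
        (w r : ℂ) * (AddCircle.toCircle (r • β) : ℂ)) atTop (𝓝 z)) ∧
      ∀ m : ℤ, Tendsto (fun N => 𝔼 r ∈ initSeg R N,
        (w r : ℂ) * (AddCircle.toCircle (r • m • α) : ℂ)) atTop
        (𝓝 (∫ x, (g x : ℂ) * fourier m x ∂(μ : Measure UnitAddCircle))) := by
  have hgi : Integrable g (μ : Measure UnitAddCircle) := Integrable.of_mem_Icc 0 1 hg.aemeasurable hg01
  -- The factor `1 / 4` leaves consecutive approximants strictly closer than `(1 / 2) ^ k`, so the
  -- bound passes to the averages for large `N`.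
  choose h h01 hgh using fun k : ℕ => exists_continuousMap_integral_sub_le
    (μ : Measure UnitAddCircle) hg hg01 (ε := (1 / 2 : ℝ) ^ k / 4) (by positivity)
  have hd : ∀ k, ∀ᶠ N in atTop,
      𝔼 r ∈ initSeg R N, |h (k + 1) (r • α) - h k (r • α)| ≤ (1 / 2 : ℝ) ^ k := by
    intro k
    have hi := fun k => (hgi.sub (integrable_continuousMap (μ : Measure UnitAddCircle) (h k))).abs
    have hlt : ∫ x, |h (k + 1) - h k| x ∂(μ : Measure UnitAddCircle) < (1 / 2 : ℝ) ^ k := by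
      calc _ ≤ ∫ x, (|g x - h k x| + |g x - h (k + 1) x|) ∂(μ : Measure UnitAddCircle) := by
            refine integral_mono (integrable_continuousMap _ _) ((hi k).add (hi (k + 1))) fun x => ?_
            have := abs_sub_le (h (k + 1) x) (g x) (h k x)
            rw [abs_sub_comm (h (k + 1) x) (g x)] at this
            simp only [ContinuousMap.abs_apply, ContinuousMap.sub_apply]
            linarith
        _ = _ := integral_add (hi k) (hi (k + 1))
        _ ≤ (1 / 2 : ℝ) ^ k / 4 + (1 / 2 : ℝ) ^ (k + 1) / 4 := add_le_add (hgh _) (hgh _)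
        _ < _ := by
            have : (0 : ℝ) < (1 / 2 : ℝ) ^ k := by positivity
            rw [pow_succ]; linarith
    exact (hμ.tendsto_real |h (k + 1) - h k|).eventually_le_const hlt
  obtain ⟨w, hw01, hw⟩ := exists_limit_in_mean hR.tendsto_card (fun k r => h01 k (r • α)) hd
  have hsmall : ∀ ε > 0, ∃ K : ℕ, 3 * (1 / 2 : ℝ) ^ K ≤ ε := fun ε hε => by
    obtain ⟨K, hK⟩ := exists_pow_lt_of_lt_one (show 0 < ε / 3 by positivity)
      (show (1 / 2 : ℝ) < 1 by norm_num)
    exact ⟨K, by linarith⟩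
  have hclose : ∀ (K : ℕ) (β : UnitAddCircle), ∀ᶠ N in atTop,
      ‖𝔼 r ∈ initSeg R N, (w r : ℂ) * (AddCircle.toCircle (r • β) : ℂ) -
        𝔼 r ∈ initSeg R N, (h K (r • α) : ℂ) * (AddCircle.toCircle (r • β) : ℂ)‖ ≤
        3 * (1 / 2 : ℝ) ^ K := by
    intro K β
    filter_upwards [hw K] with N hN
    refine le_trans ?_ hN
    rw [← Finset.expect_sub_distrib]
    refine le_trans (le_of_eq ?_) (norm_expect_mul_toCircle_le _ (fun r => w r - h K (r • α)) β)
    simp only [Complex.ofReal_sub, sub_mul]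
  let H : ℕ → C(UnitAddCircle, ℂ) := fun k =>
    ⟨fun x => (h k x : ℂ), Complex.continuous_ofReal.comp (h k).continuous⟩
  refine ⟨w, hw01, fun β => exists_tendsto_of_approx fun ε hε => ?_, fun m =>
    tendsto_of_approx fun ε hε => ?_⟩
  · obtain ⟨K, hK⟩ := hsmall ε hε
    obtain ⟨z, hz⟩ := hR.exists_tendsto_twisted α β (H K)
    exact ⟨_, z, hz, (hclose K β).mono fun N hN => hN.trans hK⟩
  · obtain ⟨K, hK⟩ := hsmall ε hε
    refine ⟨fun N => 𝔼 r ∈ initSeg R N, (h K (r • α) : ℂ) * (AddCircle.toCircle (r • m • α) : ℂ),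
      _, (hμ (H K * fourier m)).congr fun N => Finset.expect_congr rfl fun r _ => ?_, ?_,
      (hclose K _).mono fun N hN => hN.trans hK⟩
    · rw [ContinuousMap.mul_apply, fourier_apply, smul_comm]; rfl
    · have hiH := integrable_continuousMap (μ : Measure UnitAddCircle) (H K * fourier m)
      have hig : Integrable (fun x => (g x : ℂ) * fourier m x) (μ : Measure UnitAddCircle) :=
        hgi.ofReal.mul_bdd (c := 1) (fourier m).continuous.aestronglyMeasurable
          (ae_of_all _ fun x => by rw [fourier_apply, Circle.norm_coe])
      rw [← integral_sub hiH hig]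
      refine (norm_integral_le_integral_norm _).trans (le_trans (le_of_eq ?_)
        ((hgh K).trans (by linarith [show (0 : ℝ) < (1 / 2 : ℝ) ^ K by positivity])))
      refine integral_congr_ae (ae_of_all _ fun x => ?_)
      simp only [ContinuousMap.mul_apply]
      rw [← sub_mul, norm_mul, fourier_apply, Circle.norm_coe, mul_one, norm_sub_rev]
      change ‖(g x : ℂ) - (h K x : ℂ)‖ = _
      rw [← Complex.ofReal_sub, Complex.norm_real, Real.norm_eq_abs]

/-! ### Random selection by independent coins. -/

/-- The law of a coin with success probability `p`. -/
noncomputable def coinMeasure (p : ℝ) : Measure Bool :=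
  ENNReal.ofReal p • Measure.dirac true + ENNReal.ofReal (1 - p) • Measure.dirac false

theorem isProbabilityMeasure_coinMeasure {p : ℝ} (hp : p ∈ Set.Icc (0 : ℝ) 1) :
    IsProbabilityMeasure (coinMeasure p) := by
  refine ⟨?_⟩
  simp [coinMeasure]
  rw [← ENNReal.ofReal_add hp.1 (by linarith [hp.2])]
  simp

/-- The centred outcome of a coin with success probability `p`. -/
noncomputable def coinDev (p : ℝ) (b : Bool) : ℝ := (if b then 1 else 0) - p

theorem abs_coinDev_le {p : ℝ} (hp : p ∈ Set.Icc (0 : ℝ) 1) (b : Bool) : |coinDev p b| ≤ 1 := by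
  obtain ⟨h0, h1⟩ := hp
  rw [abs_le]
  cases b <;> simp [coinDev] <;> constructor <;> linarith

theorem integral_coinDev {p : ℝ} (hp : p ∈ Set.Icc (0 : ℝ) 1) :
    ∫ b, coinDev p b ∂coinMeasure p = 0 := by
  rw [coinMeasure, integral_add_measure, integral_smul_measure, integral_smul_measure,
    integral_dirac, integral_dirac, ENNReal.toReal_ofReal hp.1,
    ENNReal.toReal_ofReal (by linarith [hp.2])]
  · simp [coinDev]; ring
  all_goals exact (integrable_dirac (by simp)).smul_measure ENNReal.ofReal_ne_top

/-- Hoeffding's inequality for independent coins. -/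
theorem measure_sum_coinDev_ge_le {w : ℕ → ℝ} (hw : ∀ r, w r ∈ Set.Icc (0 : ℝ) 1)
    [∀ r, IsProbabilityMeasure (coinMeasure (w r))] {a : ℕ → ℝ} (ha : ∀ r, |a r| ≤ 1)
    (F : Finset ℕ) {ε : ℝ} (hε : 0 ≤ ε) :
    (Measure.infinitePi fun r => coinMeasure (w r)).real
      {ω | ε * F.card ≤ ∑ r ∈ F, a r * coinDev (w r) (ω r)} ≤ Real.exp (-(ε ^ 2 * F.card / 2)) := by
  have hind := ProbabilityTheory.iIndepFun_infinitePi (P := fun r => coinMeasure (w r))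
    (X := fun r b => a r * coinDev (w r) b) fun r => measurable_of_finite _
  have hsub : ∀ r ∈ F, ProbabilityTheory.HasSubgaussianMGF
      (fun ω : ℕ → Bool => a r * coinDev (w r) (ω r)) 1
      (Measure.infinitePi fun r => coinMeasure (w r)) := by
    intro r _
    have hm : Measurable fun ω : ℕ → Bool => a r * coinDev (w r) (ω r) :=
      (measurable_of_finite fun b => a r * coinDev (w r) b).comp (measurable_pi_apply r)
    -- Centred with values in `[-1, 1]`: the variance proxy is the squared half-length, namely `1`.
    have := ProbabilityTheory.hasSubgaussianMGF_of_mem_Icc_of_integral_eq_zero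
      (μ := Measure.infinitePi fun r => coinMeasure (w r)) (a := -1) (b := 1) hm.aemeasurable
      (ae_of_all _ fun ω => by
        rw [Set.mem_Icc, ← abs_le, abs_mul]
        exact mul_le_one₀ (ha r) (abs_nonneg _) (abs_coinDev_le (hw r) _)) (by
        rw [integral_const_mul]
        have := (measurePreserving_eval_infinitePi (fun r => coinMeasure (w r)) r).map_eq
        have h2 := integral_map (μ := Measure.infinitePi fun r => coinMeasure (w r))
          (measurable_pi_apply r).aemeasurable (f := coinDev (w r))
          (measurable_of_finite _).aestronglyMeasurable
        rw [this, integral_coinDev (hw r)] at h2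
        rw [← h2, mul_zero])
    convert this using 1
    ext
    norm_num
  refine (ProbabilityTheory.HasSubgaussianMGF.measure_sum_ge_le_of_iIndepFun hind hsub
    (by positivity)).trans_eq ?_
  congr 1
  rcases F.eq_empty_or_nonempty with h0 | h0
  · simp [h0]
  · have : (F.card : ℝ) ≠ 0 := by exact_mod_cast h0.card_pos.ne'
    simp
    field_simp

/-- The exceptional set of coin tosses at time `N`: one of the exponential sums at the frequencies
`j / N ^ 2` is large. -/
def badTosses (R : Set ℕ) (w : ℕ → ℝ) (ε : ℝ) (N : ℕ) : Set (ℕ → Bool) :=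
  ⋃ i ∈ Finset.range (N ^ 2) ×ˢ Finset.range 4, {ω | ε * (initSeg R N).card ≤ ∑ r ∈ initSeg R N,
    Real.cos (2 * Real.pi * (i.1 / (N : ℝ) ^ 2) * r + i.2 * (Real.pi / 2)) * coinDev (w r) (ω r)}

theorem ae_eventually_notMem_badTosses {R : Set ℕ} (hR : IsSublacunary R)
    (hcard : Tendsto (fun N => ((initSeg R N).card : ℝ)) atTop atTop) {w : ℕ → ℝ}
    (hw : ∀ r, w r ∈ Set.Icc (0 : ℝ) 1) [∀ r, IsProbabilityMeasure (coinMeasure (w r))] {ε : ℝ}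
    (hε : 0 < ε) :
    ∀ᵐ ω ∂(Measure.infinitePi fun r => coinMeasure (w r)),
      ∀ᶠ N in atTop, ω ∉ badTosses R w ε N := by
  set P := Measure.infinitePi fun r => coinMeasure (w r)
  refine ae_eventually_notMem ?_
  have hbound : ∀ᶠ N : ℕ in atTop, ‖P.real (badTosses R w ε N)‖ ≤ 4 * (1 / (N : ℝ) ^ 2) := by
    -- The constant `ε ^ 2 / 8` makes the Hoeffding exponent at least `4 log N`; each event then
    -- costs at most `N⁻⁴`, and `4 N²` of them still leave a summable total.
    have h1 := hR.eventually_le_const (show 0 < ε ^ 2 / 8 by positivity)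
    filter_upwards [h1, hcard.eventually_gt_atTop 0, eventually_gt_atTop 0] with N hN hc hN0
    have hN0' : (0 : ℝ) < N := by exact_mod_cast hN0
    rw [Real.norm_of_nonneg measureReal_nonneg]
    calc P.real (badTosses R w ε N)
        ≤ ∑ i ∈ Finset.range (N ^ 2) ×ˢ Finset.range 4,
            Real.exp (-(ε ^ 2 * (initSeg R N).card / 2)) :=
          (measureReal_biUnion_finset_le _ _).trans (Finset.sum_le_sum fun i _ =>
            measure_sum_coinDev_ge_le hw (fun r => Real.abs_cos_le_one _) _ hε.le)
      _ = 4 * (N : ℝ) ^ 2 * Real.exp (-(ε ^ 2 * (initSeg R N).card / 2)) := by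
          simp; ring
      _ ≤ 4 * (N : ℝ) ^ 2 * Real.exp (-(4 * Real.log N)) := by
          rw [div_le_iff₀ hc] at hN
          gcongr
          linarith
      _ = 4 * (1 / (N : ℝ) ^ 2) := by
          rw [Real.exp_neg, show 4 * Real.log N = Real.log ((N : ℝ) ^ 4) by simp,
            Real.exp_log (by positivity)]
          field_simp
  have hs : Summable fun N => P.real (badTosses R w ε N) :=
    Summable.of_norm_bounded_eventually_nat
      ((Real.summable_one_div_nat_pow.2 one_lt_two).mul_left 4) hbound
  exact (tsum_congr fun N => (ofReal_measureReal (μ := P)).symm).trans_ne hs.tsum_ofReal_ne_top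

theorem norm_toCircle_sub_le (r : ℕ) (x y : ℝ) :
    ‖(AddCircle.toCircle (r • (x : UnitAddCircle)) : ℂ) -
      AddCircle.toCircle (r • (y : UnitAddCircle))‖ ≤ 2 * Real.pi * r * |x - y| := by
  have h : ∀ t : ℝ, (AddCircle.toCircle (r • (t : UnitAddCircle)) : ℂ) =
      Complex.exp (Complex.I * ((2 * Real.pi * r * t : ℝ) : ℂ)) := fun t => by
    rw [← AddCircle.coe_nsmul, AddCircle.toCircle_apply_mk, Circle.coe_exp]
    congr 1
    push_cast [nsmul_eq_mul]
    ring
  rw [h, h, show Complex.exp (Complex.I * ((2 * Real.pi * r * x : ℝ) : ℂ)) =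
    Complex.exp (Complex.I * ((2 * Real.pi * r * y : ℝ) : ℂ)) *
      Complex.exp (Complex.I * ((2 * Real.pi * r * (x - y) : ℝ) : ℂ)) by
    rw [← Complex.exp_add]; congr 1; push_cast; ring, ← mul_sub_one, norm_mul, mul_comm Complex.I,
    Complex.norm_exp_ofReal_mul_I, one_mul]
  refine (Real.norm_exp_I_mul_ofReal_sub_one_le).trans_eq ?_
  rw [Real.norm_eq_abs, abs_mul, abs_of_nonneg (by positivity)]

/-- Shifting the cosine by the four quarter turns gives `cos`, `-sin`, `-cos` and `sin`, so the
one-sided bounds control the absolute values of the real and imaginary parts. -/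
theorem norm_sum_le_of_notMem_badTosses {R : Set ℕ} {w : ℕ → ℝ} {ε : ℝ} {N : ℕ} {ω : ℕ → Bool}
    (h : ω ∉ badTosses R w ε N) {j : ℕ} (hj : j < N ^ 2) :
    ‖∑ r ∈ initSeg R N, (coinDev (w r) (ω r) : ℂ) *
      (AddCircle.toCircle (r • ((j / (N : ℝ) ^ 2 : ℝ) : UnitAddCircle)) : ℂ)‖ ≤
      2 * ε * (initSeg R N).card := by
  have h' : ∀ q : ℕ, q < 4 → ∑ r ∈ initSeg R N, Real.cos (2 * Real.pi * (j / (N : ℝ) ^ 2) * r +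
      q * (Real.pi / 2)) * coinDev (w r) (ω r) < ε * (initSeg R N).card := fun q hq => by
    simp only [badTosses, Set.mem_iUnion, not_exists, Set.mem_ofPred_eq, not_le] at h
    exact h (j, q) (by simp [hj, hq])
  have hexp : ∀ r : ℕ, (AddCircle.toCircle (r • ((j / (N : ℝ) ^ 2 : ℝ) : UnitAddCircle)) : ℂ) =
      Complex.exp (((2 * Real.pi * (j / (N : ℝ) ^ 2) * r : ℝ) : ℂ) * Complex.I) := fun r => by
    rw [← AddCircle.coe_nsmul, AddCircle.toCircle_apply_mk, Circle.coe_exp]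
    congr 1
    push_cast [nsmul_eq_mul]
    ring
  refine (Complex.norm_le_abs_re_add_abs_im _).trans ?_
  rw [Complex.re_sum, Complex.im_sum]
  simp only [Complex.re_ofReal_mul, Complex.im_ofReal_mul, hexp, Complex.exp_ofReal_mul_I_re,
    Complex.exp_ofReal_mul_I_im]
  have h0 := h' 0 (by norm_num)
  have h1 := h' 1 (by norm_num)
  have h2 := h' 2 (by norm_num)
  have h3 := h' 3 (by norm_num)
  have e2 : ∀ x : ℝ, Real.cos (x + (2 : ℕ) * (Real.pi / 2)) = -Real.cos x := fun x => by
    rw [← Real.cos_add_pi]; congr 1; push_cast; ring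
  have e3 : ∀ x : ℝ, Real.cos (x + (3 : ℕ) * (Real.pi / 2)) = Real.sin x := fun x => by
    rw [← neg_neg (Real.sin x), ← Real.cos_add_pi_div_two, ← Real.cos_add_pi]
    congr 1; push_cast; ring
  simp only [e2, e3, Nat.cast_zero, zero_mul, add_zero, Nat.cast_one, one_mul,
    Real.cos_add_pi_div_two, neg_mul, Finset.sum_neg_distrib] at h0 h1 h2 h3
  simp only [mul_comm (coinDev _ _)]
  have := abs_le.2 ⟨(neg_lt.1 h2).le, h0.le⟩
  have := abs_le.2 ⟨(neg_lt.1 h1).le, h3.le⟩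
  linarith

/-- Every frequency lies within `1 / N ^ 2` of a grid point, and since `r ≤ N` this moves each term
by at most `2π / N`. The bound is uniform in `β`, so a single outcome serves all frequencies. -/
theorem norm_expect_le_of_notMem_badTosses {R : Set ℕ} {w : ℕ → ℝ}
    (hw : ∀ r, w r ∈ Set.Icc (0 : ℝ) 1) {ε : ℝ} (hε : 0 ≤ ε) {N : ℕ} (hN : 0 < N) {ω : ℕ → Bool}
    (h : ω ∉ badTosses R w ε N) (β : UnitAddCircle) :
    ‖𝔼 r ∈ initSeg R N, (coinDev (w r) (ω r) : ℂ) * (AddCircle.toCircle (r • β) : ℂ)‖ ≤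
      2 * ε + 2 * Real.pi / N := by
  obtain ⟨x, ⟨hx0, hx1⟩, rfl⟩ : ∃ x ∈ Set.Ico (0 : ℝ) 1, (x : UnitAddCircle) = β := by
    have : Fact ((0 : ℝ) < 1) := ⟨one_pos⟩
    have := (AddCircle.equivIco (1 : ℝ) 0 β).2
    exact ⟨_, by simpa only [zero_add] using this, AddCircle.coe_equivIco⟩
  have hN' : (0 : ℝ) < N := by exact_mod_cast hN
  have hN2 : (0 : ℝ) < (N : ℝ) ^ 2 := by positivity
  set j := ⌊x * (N : ℝ) ^ 2⌋₊
  have hj : j < N ^ 2 := by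
    rw [Nat.floor_lt (by positivity)]
    push_cast
    exact mul_lt_of_lt_one_left hN2 hx1
  have hxj : |x - j / (N : ℝ) ^ 2| ≤ 1 / (N : ℝ) ^ 2 := by
    have h1 : (j : ℝ) ≤ x * (N : ℝ) ^ 2 := Nat.floor_le (by positivity)
    have h2 : x * (N : ℝ) ^ 2 < j + 1 := Nat.lt_floor_add_one _
    rw [show x - j / (N : ℝ) ^ 2 = (x * (N : ℝ) ^ 2 - j) / (N : ℝ) ^ 2 by field_simp, abs_div,
      abs_of_pos hN2]
    gcongr
    rw [abs_le]; constructor <;> linarith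
  have hdiff : ‖∑ r ∈ initSeg R N, (coinDev (w r) (ω r) : ℂ) *
      (AddCircle.toCircle (r • (x : UnitAddCircle)) : ℂ) - ∑ r ∈ initSeg R N,
      (coinDev (w r) (ω r) : ℂ) *
      (AddCircle.toCircle (r • ((j / (N : ℝ) ^ 2 : ℝ) : UnitAddCircle)) : ℂ)‖ ≤
      (initSeg R N).card * (2 * Real.pi / N) := by
    rw [← Finset.sum_sub_distrib, ← nsmul_eq_mul]
    refine (norm_sum_le _ _).trans (Finset.sum_le_card_nsmul _ _ _ fun r hr => ?_)
    have hrN : (r : ℝ) ≤ N := by exact_mod_cast (mem_initSeg.1 hr).1.2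
    rw [← mul_sub, norm_mul, Complex.norm_real, Real.norm_eq_abs]
    calc _ ≤ 1 * (2 * Real.pi * N * (1 / (N : ℝ) ^ 2)) := by
          gcongr
          · exact abs_coinDev_le (hw r) _
          · exact (norm_toCircle_sub_le r _ _).trans (by gcongr)
      _ = _ := by field_simp
  have hsum := norm_sum_le_of_notMem_badTosses h hj
  rw [Finset.expect_eq_sum_div_card, norm_div, Complex.norm_natCast]
  refine div_le_of_le_mul₀ (by positivity) (by positivity) ?_
  have := norm_le_norm_add_norm_sub' (∑ r ∈ initSeg R N, (coinDev (w r) (ω r) : ℂ) *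
      (AddCircle.toCircle (r • (x : UnitAddCircle)) : ℂ)) (∑ r ∈ initSeg R N,
      (coinDev (w r) (ω r) : ℂ) *
      (AddCircle.toCircle (r • ((j / (N : ℝ) ^ 2 : ℝ) : UnitAddCircle)) : ℂ))
  linarith

/-- A random subset of a sublacunary set, selected with prescribed probabilities, has the same
exponential averages as its vector of probabilities. -/
theorem exists_subset_tendsto_zero {R : Set ℕ} (hR : IsSublacunary R)
    (hcard : Tendsto (fun N => ((initSeg R N).card : ℝ)) atTop atTop) {w : ℕ → ℝ}
    (hw : ∀ r, w r ∈ Set.Icc (0 : ℝ) 1) :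
    ∃ S ⊆ R, ∀ β : UnitAddCircle, Tendsto (fun N => 𝔼 r ∈ initSeg R N,
      (S.indicator 1 r - (w r : ℂ)) * (AddCircle.toCircle (r • β) : ℂ)) atTop (𝓝 0) := by
  have : ∀ r, IsProbabilityMeasure (coinMeasure (w r)) :=
    fun r => isProbabilityMeasure_coinMeasure (hw r)
  -- Countably many thresholds suffice, so one outcome `ω` works for all of them.
  have hae := ae_all_iff.2 fun m : ℕ => ae_eventually_notMem_badTosses hR hcard hw
    (ε := 1 / ((m : ℝ) + 1)) (by positivity)
  obtain ⟨ω, hω⟩ := hae.exists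
  refine ⟨{r ∈ R | ω r = true}, fun r hr => hr.1, fun β => ?_⟩
  have hdev : ∀ N, 𝔼 r ∈ initSeg R N, (coinDev (w r) (ω r) : ℂ) *
      (AddCircle.toCircle (r • β) : ℂ) = 𝔼 r ∈ initSeg R N,
      (Set.indicator {r ∈ R | ω r = true} 1 r - (w r : ℂ)) *
        (AddCircle.toCircle (r • β) : ℂ) := fun N => by
    refine Finset.expect_congr rfl fun r hr => ?_
    have hrR := (mem_initSeg.1 hr).2
    congr 1
    cases hb : ω r <;> simp [coinDev, hb, hrR]
  simp only [← hdev]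
  refine Metric.tendsto_nhds.2 fun ε hε => ?_
  obtain ⟨m, hm⟩ := exists_nat_one_div_lt (show 0 < ε / 4 by positivity)
  have hpi : ∀ᶠ N : ℕ in atTop, 2 * Real.pi / (N : ℝ) < ε / 2 :=
    (tendsto_natCast_atTop_atTop.const_div_atTop _).eventually_lt_const (by positivity)
  filter_upwards [hω m, hpi, eventually_gt_atTop 0] with N h1 h2 h3
  rw [dist_zero_right]
  have := norm_expect_le_of_notMem_badTosses hw (by positivity) h3 h1 β
  linarith

/-! ### Transfer from `R` to the random subset and identification of the limit. -/

/-- Integration against a probability measure on the circle as a continuous functional. -/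
noncomputable def integralFunctional (μ : Measure UnitAddCircle) [IsProbabilityMeasure μ] :
    C(UnitAddCircle, ℂ) →L[ℂ] ℂ :=
  LinearMap.mkContinuous
    { toFun := fun φ => ∫ x, φ x ∂μ
      map_add' := fun φ ψ => integral_add (integrable_continuousMap μ φ) (integrable_continuousMap μ ψ)
      map_smul' := fun c φ => integral_const_mul c _ } 1 fun φ => by
    simpa [mul_comm] using norm_integral_le_of_norm_le_const (μ := μ)
      (ae_of_all _ fun x => φ.norm_coe_le_norm x)

/-- Probability measures on the circle are determined by their Fourier coefficients. -/
theorem measure_eq_of_fourier_eq {μ ν : Measure UnitAddCircle} [IsProbabilityMeasure μ]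
    [IsProbabilityMeasure ν] (h : ∀ m : ℤ, ∫ x, fourier m x ∂μ = ∫ x, fourier m x ∂ν) : μ = ν := by
  have hdense : Dense (Submodule.span ℂ (Set.range (fourier (T := (1 : ℝ)))) :
      Set C(UnitAddCircle, ℂ)) := by
    have : Fact ((0 : ℝ) < 1) := ⟨one_pos⟩
    exact Submodule.dense_iff_topologicalClosure_eq_top.2 span_fourier_closure_eq_top
  have heq : integralFunctional μ = integralFunctional ν :=
    ContinuousLinearMap.ext_on hdense (by rintro _ ⟨m, rfl⟩; exact h m)
  refine ext_of_forall_integral_eq_of_IsFiniteMeasure fun f => ?_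
  have := DFunLike.congr_fun heq
    ⟨fun x => (f x : ℂ), Complex.continuous_ofReal.comp f.continuous⟩
  change ∫ x, (f x : ℂ) ∂μ = ∫ x, (f x : ℂ) ∂ν at this
  rw [integral_complex_ofReal, integral_complex_ofReal] at this
  exact_mod_cast this

/-- The averages over a subset of positive relative density are obtained from the averages over
the ambient set. -/
theorem tendsto_expect_of_tendsto_indicator {R S : Set ℕ} (hSR : S ⊆ R) {f : ℕ → ℂ} {d z : ℂ}
    (hd : HasRelMean R (S.indicator 1) d) (hd0 : d ≠ 0)
    (hz : Tendsto (fun N => 𝔼 r ∈ initSeg R N, S.indicator 1 r * f r) atTop (𝓝 z)) :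
    Tendsto (fun N => 𝔼 s ∈ initSeg S N, f s) atTop (𝓝 (z / d)) := by
  have hmean : ∀ N, 𝔼 r ∈ initSeg R N, S.indicator (1 : ℕ → ℂ) r =
      ((initSeg S N).card / (initSeg R N).card : ℂ) := fun N => by
    rw [Finset.expect_eq_sum_div_card, sum_initSeg_indicator hSR]
    simp
  refine (hz.div hd hd0).congr' ?_
  filter_upwards [hd.eventually_ne hd0] with N hN
  have : ∀ r, S.indicator 1 r * f r = S.indicator f r := fun r => by
    by_cases hr : r ∈ S <;> simp [hr]
  simp only [this, Pi.div_apply]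
  rw [expect_indicator hSR, ← hmean, mul_div_cancel_left₀ _ hN]

/-- A finite set has bounded counts against `#R(N) → ∞`, hence relative mean `0`. -/
theorem infinite_of_hasRelMean_ne_zero {R S : Set ℕ} (hSR : S ⊆ R)
    (hcard : Tendsto (fun N => ((initSeg R N).card : ℝ)) atTop atTop) {d : ℂ}
    (hd : HasRelMean R (S.indicator 1) d) (hd0 : d ≠ 0) : S.Infinite := by
  intro hfin
  refine hd0 (tendsto_nhds_unique hd (squeeze_zero_norm (fun N => ?_)
    (hcard.const_div_atTop (hfin.toFinset.card : ℝ))))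
  rw [Finset.expect_eq_sum_div_card, sum_initSeg_indicator hSR, norm_div, Complex.norm_natCast]
  simp only [Pi.one_apply, Finset.sum_const, nsmul_eq_mul, mul_one, Complex.norm_natCast]
  gcongr
  exact fun s hs => hfin.mem_toFinset.2 (mem_initSeg.1 hs).2

/-- Every density bounded by a multiple of a probability density is represented in a sublacunary
good set, by a subset whose relative mean is as large as possible. -/
theorem IsGoodSet.exists_represents {R : Set ℕ} (hR : IsGoodSet R) (hRsub : IsSublacunary R)
    {α : UnitAddCircle} {ρ : UnitAddCircle → ℝ} {L : ℝ} (hL : 0 < L)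
    (hρ : Integrable ρ (hR.limitMeasure α : Measure UnitAddCircle))
    (hρL : ∀ᵐ x ∂(hR.limitMeasure α : Measure UnitAddCircle), ρ x ∈ Set.Icc 0 L)
    (hρ1 : ∫ x, ρ x ∂(hR.limitMeasure α : Measure UnitAddCircle) = 1) :
    ∃ S ⊆ R, Represents S ((hR.limitMeasure α : Measure UnitAddCircle).withDensity
        (fun x => ENNReal.ofReal (ρ x))) α ∧
      HasRelMean R (S.indicator 1) ((1 / L : ℝ) : ℂ) := by
  set μ : Measure UnitAddCircle := (hR.limitMeasure α : Measure UnitAddCircle)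
  obtain ⟨w, hw01, hwconv, hwlim⟩ := hR.exists_weight (hR.isLimitMeasure α)
    (g := fun x => ρ x / L) (hρ.div_const L).aestronglyMeasurable (by
      filter_upwards [hρL] with x hx
      exact ⟨div_nonneg hx.1 hL.le, (div_le_one hL).2 hx.2⟩)
  obtain ⟨S, hSR, hS⟩ := exists_subset_tendsto_zero hRsub hR.tendsto_card hw01
  have htransfer : ∀ (β : UnitAddCircle) (z : ℂ),
      Tendsto (fun N => 𝔼 r ∈ initSeg R N, (w r : ℂ) * (AddCircle.toCircle (r • β) : ℂ))
        atTop (𝓝 z) →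
      Tendsto (fun N => 𝔼 r ∈ initSeg R N,
        S.indicator 1 r * (AddCircle.toCircle (r • β) : ℂ)) atTop (𝓝 z) := by
    intro β z hz
    have := (hS β).add hz
    rw [zero_add] at this
    refine this.congr fun N => ?_
    rw [← Finset.expect_add_distrib]
    exact Finset.expect_congr rfl fun r _ => by ring
  have hmean : HasRelMean R (S.indicator 1) ((1 / L : ℝ) : ℂ) := by
    -- The trivial character computes the relative mean as `∫ ρ / L = 1 / L`.
    have := htransfer _ _ (hwlim 0)
    simp only [zero_smul, smul_zero, AddCircle.toCircle_zero, Circle.coe_one, mul_one,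
      fourier_zero] at this
    rwa [integral_complex_ofReal, integral_div, hρ1] at this
  have hL0 : ((1 / L : ℝ) : ℂ) ≠ 0 := by exact_mod_cast (one_div_pos.2 hL).ne'
  have hgood : IsGoodSet S :=
    { zero_notMem := fun h => hR.zero_notMem (hSR h)
      infinite := infinite_of_hasRelMean_ne_zero hSR hR.tendsto_card hmean hL0
      exists_tendsto := fun β => by
        obtain ⟨z, hz⟩ := hwconv β
        exact ⟨_, tendsto_expect_of_tendsto_indicator hSR hmean hL0 (htransfer β z hz)⟩ }
  set ν := μ.withDensity fun x => ENNReal.ofReal (ρ x)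
  have hν1 : ν Set.univ = 1 := by
    rw [withDensity_apply _ MeasurableSet.univ, Measure.restrict_univ,
      ← ofReal_integral_eq_lintegral_ofReal hρ (hρL.mono fun x hx => hx.1), hρ1, ENNReal.ofReal_one]
  have : IsProbabilityMeasure ν := ⟨hν1⟩
  refine ⟨S, hSR, ⟨hgood, ?_⟩, hmean⟩
  rw [hν1, inv_one, one_smul]
  refine measure_eq_of_fourier_eq fun m => ?_
  -- Dividing the coefficient of `(ρ / L) μ` by the relative mean `1 / L` cancels `L`, leaving that
  -- of `ρ μ`.
  have h1 := tendsto_expect_of_tendsto_indicator hSR hmean hL0 (htransfer _ _ (hwlim m))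
  have h2 := hgood.isLimitMeasure α (fourier m)
  simp only [fourier_apply, smul_comm m] at h2
  have h3 := tendsto_nhds_unique h2 h1
  simp only [← fourier_apply] at h3
  rw [h3, integral_withDensity_eq_integral_toReal_smul₀ hρ.aemeasurable.ennreal_ofReal
    (ae_of_all _ fun _ => ENNReal.ofReal_lt_top), ← integral_div]
  refine integral_congr_ae ?_
  filter_upwards [hρL] with x hx
  have : (L : ℂ) ≠ 0 := by exact_mod_cast hL.ne'
  rw [ENNReal.toReal_ofReal hx.1, Complex.real_smul]
  push_cast
  field_simp

theorem mainTheorem5 (R : Set ℕ) (hR : IsGoodSet R) (hRsub : IsSublacunary R) :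
    (∀ α : ℝ, Irrational α →
      ∀ ρ : UnitAddCircle → ℝ,
        0 ≤ᵐ[(hR.limitMeasure (α : UnitAddCircle) : Measure UnitAddCircle)] ρ →
        Integrable ρ (hR.limitMeasure (α : UnitAddCircle) : Measure UnitAddCircle) →
        ∫ x, ρ x ∂(hR.limitMeasure (α : UnitAddCircle) : Measure UnitAddCircle) = 1 →
        eLpNorm ρ ∞ (hR.limitMeasure (α : UnitAddCircle) : Measure UnitAddCircle) < ∞ →
        ∃ S : Set ℕ, S ⊆ R ∧
          Represents S
            ((hR.limitMeasure (α : UnitAddCircle) : Measure UnitAddCircle).withDensity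
              (fun x => ENNReal.ofReal (ρ x)))
            (α : UnitAddCircle) ∧
          HasRelMean R (S.indicator 1)
            (((1 / (eLpNorm ρ ∞
              (hR.limitMeasure (α : UnitAddCircle) : Measure UnitAddCircle)).toReal : ℝ)) : ℂ)) ∧
    (∀ (S : Set ℕ) (hS : IsGoodSet S), S ⊆ R → 0 < relNorm R (S.indicator 1) →
      ∀ β : UnitAddCircle,
        (hS.limitMeasure β : Measure UnitAddCircle) ≪
          (hR.limitMeasure β : Measure UnitAddCircle) ∧
        eLpNorm ((hS.limitMeasure β : Measure UnitAddCircle).rnDeriv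
            (hR.limitMeasure β : Measure UnitAddCircle)) ∞
            (hR.limitMeasure β : Measure UnitAddCircle) ≤
          1 / relNorm R (S.indicator 1)) := by
  refine ⟨fun α _ ρ hρ0 hρ hρ1 hρb => ?_, fun S hS hSR h0 β =>
    absolutelyContinuous_and_rnDeriv_le hSR (hS.isLimitMeasure β) (hR.isLimitMeasure β) h0⟩
  -- A vanishing essential supremum would force `ρ = 0` a.e., against `∫ ρ = 1`; so `L = ‖ρ‖_∞` is
  -- positive.
  have hne : eLpNorm ρ ∞ (hR.limitMeasure (α : UnitAddCircle) : Measure UnitAddCircle) ≠ 0 := by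
    intro h
    rw [eLpNorm_eq_zero_iff hρ.aestronglyMeasurable ENNReal.top_ne_zero] at h
    simp [integral_congr_ae h] at hρ1
  refine hR.exists_represents hRsub (ENNReal.toReal_pos hne hρb.ne) hρ ?_ hρ1
  filter_upwards [hρ0, ae_le_eLpNormEssSup (f := ρ)
    (μ := (hR.limitMeasure (α : UnitAddCircle) : Measure UnitAddCircle))] with x hx0 hx
  refine ⟨hx0, (le_abs_self _).trans ?_⟩
  rw [← Real.norm_eq_abs, ← toReal_enorm]
  exact ENNReal.toReal_mono hρb.ne (by rwa [eLpNorm_exponent_top])
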